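/- A $(K,K',N)$ hotplug coded caching system has a server with $N\ge 1$ files of $B$ bits each and $K$ users, each with a cache of $MB$ bits. The caches are filled as functions of the files, before it is known which users will be active. Afterwards a set $I$ of exactly $K'$ users becomes active, each $k\in I$ demands a file $d_k$, and the server broadcasts at most $RB$ bits, depending on the files, on $I$ and on the demands, from which each active user, using its cache, must recover its demanded file without error, for every $I$, all demands and all files. The pair $(M,R)$ is achievable if this is possible for some $B\ge1$. The cut-set bound for $N$ files and $K'$ users is $\max_{1\le s\le\min(N,K')}\bigl(s-\frac{s}{\lfloor N/s\rfloor}M\bigr)$. Let $K\ge 6$ be even, let $N\ge 1$, and let $a,a_1,a_2$ be integers with $0\le a_1\le\binom{K-4}{2}$, $0\le a_2\le\frac32(K-4)$, $0\le a<a_2$ and $\binom{K-1}{2}=a+3a_1+2a_2$. Put $$\frac MN=\frac{\binom{K-1}{2}}{3(a_1+a_2)},\qquad R=\frac{3(a_1+a_2)-\binom{K-1}{2}}{3(a_1+a_2)}=1-\frac MN .$$ Then $(M,R)$ is achievable for the $(K,3,N)$ hotplug coded caching system, $R$ equals the cut-set bound for $N$ files and $3$ users at memory $M$, and the point is optimal: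 every rate achievable with memory $M$ is at least $R$. Moreover the point is attained by the improved $t$-scheme of $3$-$(K,4,3)$ designs, as follows. There exists a $3$-$(K,4,3)$ design on the point set $[K]$ (a family of $b$ blocks of size $4$, repetitions allowed, such that every three points lie in exactly $3$ blocks). For each such design with blocks $A_1,\dots,A_b$, let $P$ be the $b\times K$ array with a star at $(f,k)$ if $k\in A_f$ and a null entry otherwise, and let $B$ be the array with columns $[3]$ and rows $(Y,i)$, where $Y\subset[3]$, $|Y|\in\{1,2\}$, $1\le i\le a_{|Y|}$, whose entry at $((Y,i),j)$ is a star if $j\in Y$ and the symbol $(Y\cup\{j\},i)$ otherwise. Then: 1. $(P,B)$ is a $(K,3,F,F',Z,Z',S)$ hotplug placement delivery array with $F=b$, $F'=3(a_1+a_2)$, $Z=\binom{K-1}{2}$, $Z'=a_1+2a_2$, $S=3a_1+a_2$. That is: $F'\le F$ and $Z<F'$; each column of $P$ has $Z$ stars; $B$ has $F'$ rows, $S$ symbols, each of which occurs, and $Z'$ stars in each column, and two different positions of $B$ with the same symbol lie in different rows and columns, the other two corners of the rectangle they span being stars; and for every $3$-subset $I$ of $[K]$ there are $F'$ rows of $P$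 which, suitably ordered, have in the columns $I$ (in increasing order) exactly the star positions of $B$. 2. There is a set $T$ of symbols of $B$ with at most $Z-Z'$ elements in each column of $B$ and with $R=(S-|T|)/F'$, such that the following scheme is correct for every finite field $\mathbb F$, every $[F,F']$ MDS code over $\mathbb F$, and every choice, for each $I$, of $F'$ ordered rows $\zeta_I$ as in 1. Each file is split into $F'$ subfiles in $\mathbb F$, which are encoded by the MDS code into coded subfiles $C_{n,f}$, $f\in[F]$; user $k$ stores all $C_{n,f}$ with a star at $(f,k)$ in $P$; when the users in $I$ demand the files $d_k$, $k\in I$, the server sends for each symbol $x\notin T$ the sum of the $C_{d_k,f}$ over the positions $(f,k)$ of $x$ in the array obtained by placing $B$ on the rows $\zeta_I$ and the columns $I$. Such MDS codes exist over every finite field with at least $b$ elements. -/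

import Mathlib

/-! ### Hotplug coded caching systems -/

/-- The placement and delivery maps of a `(K, K', N)` hotplug coded caching scheme.
The placement of user `k` depends on the `N` files only; the transmission depends moreover on the
set `I` of the `K'` active users and on their demands `d`. -/
structure HotplugScheme (K K' N : ℕ) (File : Type*) (Cache : Fin K → Type*) (Signal : Type*) where
  place : (k : Fin K) → (Fin N → File) → Cache k
  deliver : (I : Finset (Fin K)) → I.card = K' → (I → Fin N) → (Fin N → File) → Signal

/-- Every active user recovers the file it demands, without error, from its cache and the
transmission, for all active sets of size `K'`, all demands and all file contents. -/
def HotplugScheme.Correct {K K' N : ℕ} {File : Type*} {Cache : Fin K → Type*} {Signal : Type*}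
    (s : HotplugScheme K K' N File Cache Signal) : Prop :=
  ∀ (I : Finset (Fin K)) (hI : I.card = K') (d : I → Fin N) (k : I),
    ∃ dec : Cache k → Signal → File,
      ∀ W : Fin N → File, dec (s.place k W) (s.deliver I hI d W) = W (d k)

/-- The memory-rate pair `(M, R)` is achievable for the `(K, K', N)` hotplug system: for some file
size of `B` bits there is a correct scheme whose caches hold at most `M * B` bits and whose
transmissions have at most `R * B` bits. -/
def HotplugAchievable (K K' N : ℕ) (M R : ℝ) : Prop :=
  ∃ B c l : ℕ, 0 < B ∧ (c : ℝ) ≤ M * B ∧ (l : ℝ) ≤ R * B ∧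
    ∃ s : HotplugScheme K K' N (Fin B → Bool) (fun _ => Fin c → Bool) (Fin l → Bool), s.Correct

/-- The numbers `s - s / ⌊N / s⌋ * M` for `1 ≤ s ≤ min (N, K')`, whose maximum is the
cut-set bound for `N` files, `K'` users and cache size `M` files. -/
def cutSetValues (N K' : ℕ) (M : ℝ) : Set ℝ :=
  (fun s : ℕ => (s : ℝ) - (s : ℝ) / ((N / s : ℕ) : ℝ) * M) '' Set.Icc 1 (min N K')

/-! ### Placement delivery arrays -/

/-- A `[K', F', Z', S]` placement delivery array with rows `ρ` and integers `σ`;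
the entry `none` is the star. -/
structure IsPDA {ρ σ : Type*} [Fintype ρ] [Fintype σ] {K' : ℕ} (B : ρ → Fin K' → Option σ)
    (F' Z' S : ℕ) : Prop where
  card_rows : Fintype.card ρ = F'
  card_integers : Fintype.card σ = S
  stars : ∀ k, {r | B r k = none}.ncard = Z'
  occurs : ∀ x : σ, ∃ r k, B r k = some x
  cross : ∀ (r₁ r₂ : ρ) (k₁ k₂ : Fin K') (x : σ), (r₁, k₁) ≠ (r₂, k₂) →
    B r₁ k₁ = some x → B r₂ k₂ = some x →
      r₁ ≠ r₂ ∧ k₁ ≠ k₂ ∧ B r₁ k₂ = none ∧ B r₂ k₁ = none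

/-- The rows `ψ r` of `P` and the columns of `P` in `I` (taken in increasing order) form a subarray
with the same star positions as `B`. Here `P f k` means that the entry `(f, k)` of `P` is a star. -/
def StarAligned {φ ρ σ : Type*} {K K' : ℕ} (P : φ → Fin K → Prop) (B : ρ → Fin K' → Option σ)
    (I : Finset (Fin K)) (hI : I.card = K') (ψ : ρ ↪ φ) : Prop :=
  ∀ r j, P (ψ r) (I.orderIsoOfFin hI j) ↔ B r j = none

/-- `(P, B)` is a `(K, K', F, F', Z, Z', S)` hotplug placement delivery array. -/
structure IsHpPDA {φ ρ σ : Type*} [Fintype φ] [Fintype ρ] [Fintype σ] {K K' : ℕ}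
    (P : φ → Fin K → Prop) (B : ρ → Fin K' → Option σ) (F F' Z Z' S : ℕ) : Prop where
  users : K' ≤ K
  rows : F' ≤ F
  memory : Z < F'
  card_rows : Fintype.card φ = F
  stars : ∀ k, {f | P f k}.ncard = Z
  pda : IsPDA B F' Z' S
  aligned : ∀ (I : Finset (Fin K)) (hI : I.card = K'), ∃ ψ : ρ ↪ φ, StarAligned P B I hI ψ

/-- A set `T` of integers whose transmissions may be dropped: each column of `B` contains at most
`Z - Z'` of them. -/
def IsRemovable {ρ σ : Type*} {K' : ℕ} (B : ρ → Fin K' → Option σ) (Z Z' : ℕ) (T : Finset σ) :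
    Prop :=
  ∀ k, {x | x ∈ T ∧ ∃ r, B r k = some x}.ncard + Z' ≤ Z

/-- `G` generates an MDS code: every square submatrix formed by as many columns as there are rows
is invertible. -/
def IsMDS {ρ φ 𝔽 : Type*} [Fintype ρ] [DecidableEq ρ] [Field 𝔽] (G : Matrix ρ φ 𝔽) : Prop :=
  ∀ e : ρ ↪ φ, (G.submatrix id e).det ≠ 0

/-- The coded subfile `C_{n, f}`. -/
def codedSubfile {ρ φ 𝔽 : Type*} [Fintype ρ] [Field 𝔽] {N : ℕ} (G : Matrix ρ φ 𝔽)
    (W : Fin N → ρ → 𝔽) (n : Fin N) (f : φ) : 𝔽 :=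
  ∑ r, G r f * W n r

/-- The hotplug coded caching scheme of a hotplug placement delivery array, with the transmissions
of the integers in `T` removed. Each file consists of subfiles in `𝔽` indexed by `ρ`. User `k`
stores the coded subfiles `C_{n, f}` with a star at `(f, k)`. For each integer `x ∉ T` the server
sends the sum of the coded subfiles `C_{d_k, f}` over all positions `(f, k)` of `x` in the array
obtained by placing `B` on the rows `ζ I` and the columns `I` of `P`. -/
def hpPDAScheme {φ ρ σ 𝔽 : Type*} [Fintype ρ] [DecidableEq σ] [Field 𝔽] {K K' : ℕ} (N : ℕ)
    (P : φ → Fin K → Prop) (B : ρ → Fin K' → Option σ)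
    (ζ : (I : Finset (Fin K)) → I.card = K' → (ρ ↪ φ)) (T : Finset σ) (G : Matrix ρ φ 𝔽) :
    HotplugScheme K K' N (ρ → 𝔽) (fun k => Fin N → {f : φ // P f k} → 𝔽)
      ({x : σ // x ∉ T} → 𝔽) where
  place _ W n f := codedSubfile G W n f.1
  deliver I hI d W x :=
    ∑ r : ρ, ∑ j : Fin K', if B r j = some x.1 then
      codedSubfile G W (d (I.orderIsoOfFin hI j)) (ζ I hI r) else 0

/-! ### Arrays from `t`-designs -/

/-- The family `blk` of blocks, repetitions being allowed, is a `t`-`(v, k, lam)` design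
on the point set `Fin v`. -/
structure IsTDesign {β : Type*} (t v k lam : ℕ) (blk : β → Finset (Fin v)) : Prop where
  t_pos : 0 < t
  lam_pos : 0 < lam
  t_le : t ≤ k
  k_lt : k < v
  card_block : ∀ i, (blk i).card = k
  balanced : ∀ Y : Finset (Fin v), Y.card = t → {i | Y ⊆ blk i}.ncard = lam

/-- The transposed incidence matrix of a design. -/
def designArray {β : Type*} {v : ℕ} (blk : β → Finset (Fin v)) (i : β) (x : Fin v) : Prop :=
  x ∈ blk i

/-- The row indices `(Y, i)` with `Y ⊆ [t]`, `1 ≤ |Y| ≤ t - 1` and `i ∈ [a_{|Y|}]`. -/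
abbrev TRow (t : ℕ) (a : ℕ → ℕ) : Type :=
  Σ Y : {Y : Finset (Fin t) // 1 ≤ Y.card ∧ Y.card < t}, Fin (a Y.1.card)

/-- The integers `(Y', i)` with `Y' ⊆ [t]`, `|Y'| = s + 1` for some `1 ≤ s ≤ t - 1`, and
`i ∈ [a_s]`. -/
abbrev TLabel (t : ℕ) (a : ℕ → ℕ) : Type :=
  Σ Y : {Y : Finset (Fin t) // 2 ≤ Y.card}, Fin (a (Y.1.card - 1))

/-- The array with entry `*` at `((Y, i), j)` if `j ∈ Y`, and `(Y ∪ {j}, i)` otherwise. -/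
def tArray (t : ℕ) (a : ℕ → ℕ) (r : TRow t a) (j : Fin t) : Option (TLabel t a) :=
  if h : j ∈ r.1.1 then none
  else some ⟨⟨insert j r.1.1, by
      rw [Finset.card_insert_of_notMem h]; have := r.1.2.1; omega⟩,
    Fin.cast (by simp [Finset.card_insert_of_notMem h]) r.2⟩

/-- The multiplicities `a_1, a_2` for `t = 3`. -/
def levels (a₁ a₂ : ℕ) : ℕ → ℕ := fun s => if s = 1 then a₁ else if s = 2 then a₂ else 0

/-!
By the MDS property, any `F'` coded subfiles of a file determine it. A user caches `Z` coded
subfiles of each file, and each transmitted symbol in its column gives one more of the file it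
demands, because the other summands lie in rows with a star in that column; so the user can afford
to miss `Z - Z'` symbols.

For a `t`-design, the number of blocks that contain a set `X` and avoid a disjoint set `Y`, where
`|X| + |Y| ≤ t`, satisfies Pascal's recurrence and hence is proportional to a binomial
coefficient depending on `|X|` and `|Y|` only. Every `t`-set of points thus meets enough blocks in each of its
subsets for the rows of the `t`-scheme to be found. For `3`-`(K, 4, 3)` designs and
`C(K-1, 2) = a + 3 a₁ + 2 a₂`, dropping the symbols `([3], i)` with `i ≤ a` and all symbols
`(Y, i)` with `|Y| = 2` uses the surplus `Z - Z' = a + 2 a₁` exactly.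

A `3`-`(K, 4, 3)` design with `K` even comes from the one-factorization of the complete graph on
`ℤ/(K-1) ∪ {∞}` by the reflections of `ℤ/(K-1)`: the blocks are the unions of two edges of a common
factor, and each of the three pairs in a triple `x, y, z` lies in one factor, which gives one block.

Optimality is the cut-set bound for a single user, `1 ≤ M / N + R`, which dominates the bounds for
two and three users because `M / N ≥ 1 / 3`.
-/

/-! ### Correctness of the scheme of a hotplug placement delivery array -/

theorem HotplugScheme.correct_iff {K K' N : ℕ} {File : Type*} [Nonempty File]
    {Cache : Fin K → Type*} {Signal : Type*} {s : HotplugScheme K K' N File Cache Signal} :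
    s.Correct ↔ ∀ (I : Finset (Fin K)) (hI : I.card = K') (d : I → Fin N) (k : I)
      (W W' : Fin N → File), s.place k W = s.place k W' →
        s.deliver I hI d W = s.deliver I hI d W' → W (d k) = W' (d k) := by
  constructor
  · intro hs I hI d k W W' hplace hdeliver
    obtain ⟨dec, hdec⟩ := hs I hI d k
    rw [← hdec W, ← hdec W', hplace, hdeliver]
  · intro hs I hI d k
    have hfactors : (fun W : Fin N → File => W (d k)).FactorsThrough
        fun W => (s.place k W, s.deliver I hI d W) := fun W W' hWW' =>
      hs I hI d k W W' (congrArg Prod.fst hWW') (congrArg Prod.snd hWW')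
    obtain ⟨dec, hdec⟩ := (Function.factorsThrough_iff _).mp hfactors
    exact ⟨fun p q => dec (p, q), fun W => (congrFun hdec W).symm⟩

section Array

variable {φ ρ σ 𝔽 : Type*} [Fintype ρ] {K' F' Z Z' S : ℕ} {B : ρ → Fin K' → Option σ}
  {T : Finset σ}

theorem IsMDS.eq_of_codedSubfile_eq [DecidableEq ρ] [Field 𝔽] {N : ℕ} {G : Matrix ρ φ 𝔽}
    (hG : IsMDS G) {W W' : Fin N → ρ → 𝔽} {n : Fin N} (e : ρ ↪ φ)
    (h : ∀ r, codedSubfile G W n (e r) = codedSubfile G W' n (e r)) : W n = W' n := by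
  refine sub_eq_zero.mp (Matrix.eq_zero_of_vecMul_eq_zero (hG e) (funext fun r => ?_))
  simpa [codedSubfile, Matrix.vecMul, dotProduct, mul_comm (G _ _), sub_mul, Finset.sum_sub_distrib,
    sub_eq_zero] using h r

theorem exists_isMDS [DecidableEq ρ] [Fintype φ] [Field 𝔽] [Fintype 𝔽]
    (h : Fintype.card φ ≤ Fintype.card 𝔽) : ∃ G : Matrix ρ φ 𝔽, IsMDS G := by
  obtain ⟨α⟩ : Nonempty (φ ↪ 𝔽) := Function.Embedding.nonempty_of_card_le h
  let e := Fintype.equivFin ρ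
  refine ⟨Matrix.of fun r f => α f ^ (e r : ℕ), fun ψ => ?_⟩
  have hdet := Matrix.det_vandermonde_ne_zero_iff.mpr
    (α.injective.comp (ψ.injective.comp e.symm.injective))
  rw [← Matrix.det_transpose, ← Matrix.det_submatrix_equiv_self e] at hdet
  convert hdet using 2
  ext r r'
  simp [Matrix.vandermonde]

variable [Fintype σ]

theorem IsPDA.eq_of_eq_some (h : IsPDA B F' Z' S) {r₁ r₂ : ρ} {k : Fin K'} {x : σ}
    (h₁ : B r₁ k = some x) (h₂ : B r₂ k = some x) : r₁ = r₂ := by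
  by_contra hne
  exact (h.cross r₁ r₂ k k x (by simpa using hne) h₁ h₂).2.1 rfl

theorem IsPDA.ncard_rows_mem_le (h : IsPDA B F' Z' S) (T : Finset σ) (k : Fin K') :
    {r | ∃ x ∈ T, B r k = some x}.ncard ≤ {x | x ∈ T ∧ ∃ r, B r k = some x}.ncard := by
  rw [← Set.ncard_image_of_injective _ (Option.some_injective σ)]
  refine Set.ncard_le_ncard_of_injOn (B · k) ?_ ?_
  · rintro r ⟨x, hx, hr⟩
    exact ⟨x, ⟨hx, r, hr⟩, hr.symm⟩
  · rintro r ⟨x, -, hr⟩ r' - heq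
    exact h.eq_of_eq_some hr (heq.symm.trans hr)

theorem IsPDA.le_add_ncard_rows_notMem (h : IsPDA B F' Z' S) (hT : IsRemovable B Z Z' T)
    (k : Fin K') : F' ≤ Z + {r | ∃ x ∉ T, B r k = some x}.ncard := by
  have hcover : {r | B r k = none} ∪ {r | ∃ x ∈ T, B r k = some x} ∪
      {r | ∃ x ∉ T, B r k = some x} = Set.univ := by
    ext r
    rcases hr : B r k with _ | x
    · simp [hr]
    · by_cases hx : x ∈ T <;> simp [hr, hx]
  calc F' = (Set.univ : Set ρ).ncard := by
        rw [Set.ncard_univ, Nat.card_eq_fintype_card, h.card_rows]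
    _ ≤ {r | B r k = none}.ncard + {r | ∃ x ∈ T, B r k = some x}.ncard +
        {r | ∃ x ∉ T, B r k = some x}.ncard := by
      rw [← hcover]
      exact (Set.ncard_union_le _ _).trans (by gcongr; exact Set.ncard_union_le _ _)
    _ ≤ Z + {r | ∃ x ∉ T, B r k = some x}.ncard := by
      have hstars := h.stars k
      have hremoved := (h.ncard_rows_mem_le T k).trans (Nat.le_sub_of_add_le (hT k))
      have hle := hT k
      omega

/-- Every other term of the transmission of `x` is cached by the user in column `j`, since the array
has a star in that column. -/
theorem IsPDA.codedSubfile_eq_of_deliver_eq [DecidableEq σ] [Field 𝔽] {K N : ℕ}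
    (h : IsPDA B F' Z' S) {P : φ → Fin K → Prop} {G : Matrix ρ φ 𝔽}
    {ζ : (I : Finset (Fin K)) → I.card = K' → (ρ ↪ φ)} {I : Finset (Fin K)} {hI : I.card = K'}
    (hζ : StarAligned P B I hI (ζ I hI)) {d : I → Fin N} {W W' : Fin N → ρ → 𝔽} {j : Fin K'}
    (hcached : ∀ n f, P f (I.orderIsoOfFin hI j) → codedSubfile G W n f = codedSubfile G W' n f)
    (hdeliver : (hpPDAScheme N P B ζ T G).deliver I hI d W =
      (hpPDAScheme N P B ζ T G).deliver I hI d W')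
    {r : ρ} {x : σ} (hx : x ∉ T) (hr : B r j = some x) :
    codedSubfile G W (d (I.orderIsoOfFin hI j)) (ζ I hI r) =
      codedSubfile G W' (d (I.orderIsoOfFin hI j)) (ζ I hI r) := by
  let term (V : Fin N → ρ → 𝔽) (p : ρ × Fin K') : 𝔽 := if B p.1 p.2 = some x then
    codedSubfile G V (d (I.orderIsoOfFin hI p.2)) (ζ I hI p.1) else 0
  have hsum : ∑ p, term W p = ∑ p, term W' p := by
    rw [Fintype.sum_prod_type, Fintype.sum_prod_type]
    exact congrFun hdeliver ⟨x, hx⟩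
  have hothers : ∀ p, p ≠ (r, j) → term W p - term W' p = 0 := by
    rintro ⟨r', j'⟩ hp
    by_cases hr' : B r' j' = some x
    · have hstar : B r' j = none := (h.cross r r' j j' x hp.symm hr hr').2.2.2
      simp only [term, hr', if_true, hcached _ _ ((hζ r' j).mpr hstar), sub_self]
    · simp only [term, hr', if_false, sub_self]
  have hdiff : term W (r, j) - term W' (r, j) = 0 := by
    rw [← Fintype.sum_eq_single _ hothers, Finset.sum_sub_distrib, hsum, sub_self]
  simpa only [term, hr, if_true, sub_eq_zero] using hdiff

theorem IsHpPDA.le_ncard_known [Fintype φ] {K F : ℕ} {P : φ → Fin K → Prop}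
    (h : IsHpPDA P B F F' Z Z' S) (hT : IsRemovable B Z Z' T) {I : Finset (Fin K)}
    {hI : I.card = K'} {ψ : ρ ↪ φ} (hψ : StarAligned P B I hI ψ) (j : Fin K') :
    F' ≤ ({f | P f (I.orderIsoOfFin hI j)} ∪ ψ '' {r | ∃ x ∉ T, B r j = some x}).ncard := by
  have hdisj : Disjoint {f | P f (I.orderIsoOfFin hI j)}
      (ψ '' {r | ∃ x ∉ T, B r j = some x}) := by
    rw [Set.disjoint_left]
    rintro _ hcached ⟨r, ⟨x, -, hx⟩, rfl⟩
    simp [(hψ r j).mp hcached] at hx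
  rw [Set.ncard_union_eq hdisj, Set.ncard_image_of_injective _ ψ.injective, h.stars]
  exact h.pda.le_add_ncard_rows_notMem hT j

theorem IsHpPDA.correct_hpPDAScheme [Fintype φ] [DecidableEq ρ] [DecidableEq σ] [Field 𝔽]
    {K F N : ℕ} {P : φ → Fin K → Prop} (h : IsHpPDA P B F F' Z Z' S) (hT : IsRemovable B Z Z' T)
    {G : Matrix ρ φ 𝔽} (hG : IsMDS G) {ζ : (I : Finset (Fin K)) → I.card = K' → (ρ ↪ φ)}
    (hζ : ∀ I hI, StarAligned P B I hI (ζ I hI)) : (hpPDAScheme N P B ζ T G).Correct := by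
  classical
  refine HotplugScheme.correct_iff.mpr fun I hI d k W W' hplace hdeliver => ?_
  obtain ⟨j, rfl⟩ := (I.orderIsoOfFin hI).surjective k
  have hcached : ∀ n f, P f (I.orderIsoOfFin hI j) →
      codedSubfile G W n f = codedSubfile G W' n f :=
    fun n f hf => congrFun (congrFun hplace n) ⟨f, hf⟩
  obtain ⟨e⟩ : Nonempty (ρ ↪ ↥({f | P f (I.orderIsoOfFin hI j)} ∪
      ζ I hI '' {r | ∃ x ∉ T, B r j = some x})) := by
    rw [Function.Embedding.nonempty_iff_card_le, h.pda.card_rows, ← Nat.card_eq_fintype_card,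
      Nat.card_coe_set_eq]
    exact h.le_ncard_known hT (hζ I hI) j
  refine hG.eq_of_codedSubfile_eq (e.trans (.subtype _)) fun r => ?_
  rcases (e r).2 with hf | ⟨r', ⟨x, hx, hr'⟩, hf⟩
  · exact hcached _ _ hf
  · have hdecoded := h.pda.codedSubfile_eq_of_deliver_eq (hζ I hI) hcached hdeliver hx hr'
    rwa [hf] at hdecoded

end Array

/-! ### The array of the `t`-scheme -/

section TArray

open Finset

theorem sum_filter_card {α : Type*} [Fintype α] (p : ℕ → Prop) [DecidablePred p] (g : ℕ → ℕ) :
    ∑ Y : Finset α with p #Y, g #Y =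
      ∑ s ∈ range (Fintype.card α + 1) with p s, (Fintype.card α).choose s * g s := by
  simpa [sum_filter, mul_ite] using
    sum_powerset_apply_card (fun s => if p s then g s else 0) (x := (univ : Finset α))

theorem sum_filter_card_mem {α : Type*} [DecidableEq α] [Fintype α] (p : ℕ → Prop)
    [DecidablePred p] (g : ℕ → ℕ) (j : α) :
    ∑ Y : Finset α with p #Y ∧ j ∈ Y, g #Y =
      ∑ s ∈ range (Fintype.card α) with p (s + 1), (Fintype.card α - 1).choose s * g (s + 1) := by
  have hpos : 0 < Fintype.card α := Fintype.card_pos_iff.mpr ⟨j⟩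
  have herase : ∑ Y : Finset α with p #Y ∧ j ∈ Y, g #Y =
      ∑ Y ∈ (univ.erase j).powerset with p (#Y + 1), g (#Y + 1) := by
    refine sum_nbij' (erase · j) (insert j ·) ?_ ?_ ?_ ?_ ?_
    · intro Y hY
      obtain ⟨hp, hj⟩ := (mem_filter.mp hY).2
      rw [mem_filter, card_erase_add_one hj]
      exact ⟨mem_powerset.mpr (erase_subset_erase j (subset_univ Y)), hp⟩
    · intro Y hY
      obtain ⟨hsub, hp⟩ := mem_filter.mp hY
      have hj : j ∉ Y := fun hj => notMem_erase j univ (mem_powerset.mp hsub hj)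
      rw [mem_filter, card_insert_of_notMem hj]
      exact ⟨mem_univ _, hp, mem_insert_self j Y⟩
    · exact fun Y hY => insert_erase (mem_filter.mp hY).2.2
    · exact fun Y hY => erase_insert fun hj =>
        notMem_erase j univ (mem_powerset.mp (mem_filter.mp hY).1 hj)
    · exact fun Y hY => by rw [card_erase_add_one (mem_filter.mp hY).2.2]
  rw [herase, sum_filter, sum_powerset_apply_card fun s => if p (s + 1) then g (s + 1) else 0,
    card_erase_of_mem (mem_univ j), card_univ, Nat.sub_add_cancel hpos, sum_filter]
  simp only [smul_eq_mul, mul_ite, mul_zero]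

variable {t : ℕ} {a c : ℕ → ℕ} {r : TRow t a} {j : Fin t} {x : TLabel t a}

theorem tArray_eq_none_iff : tArray t a r j = none ↔ j ∈ r.1.1 := by
  unfold tArray
  split_ifs with h <;> simp [h]

theorem tArray_eq_some_iff :
    tArray t a r j = some x ↔ j ∉ r.1.1 ∧ x.1.1 = insert j r.1.1 ∧ (x.2 : ℕ) = r.2 := by
  obtain ⟨⟨Y, hY⟩, i⟩ := x
  unfold tArray
  split_ifs with h
  · simp [h]
  · simp only [Option.some.injEq, h, not_false_eq_true, true_and]
    constructor
    · rintro ⟨⟩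
      simp
    · rintro ⟨rfl, hi⟩
      congr 1
      exact Fin.ext (by simpa using hi.symm)

theorem TRow.ext_val {r r' : TRow t a} (hY : r.1.1 = r'.1.1) (hi : (r.2 : ℕ) = r'.2) : r = r' := by
  obtain ⟨⟨Y, hY'⟩, i⟩ := r
  obtain ⟨⟨Y', hY''⟩, i'⟩ := r'
  obtain rfl : Y = Y' := hY
  exact congrArg _ (Fin.ext hi)

theorem exists_tArray_eq_some_iff : (∃ r, tArray t a r j = some x) ↔ j ∈ x.1.1 := by
  constructor
  · rintro ⟨r, hr⟩
    exact (tArray_eq_some_iff.mp hr).2.1 ▸ mem_insert_self _ _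
  · intro hj
    obtain ⟨⟨Y, hY⟩, i⟩ := x
    have hcard : #(Y.erase j) = #Y - 1 := card_erase_of_mem hj
    have hle : #Y ≤ t := card_finset_fin_le Y
    exact ⟨⟨⟨Y.erase j, by omega, by omega⟩, Fin.cast (by rw [hcard]) i⟩,
      tArray_eq_some_iff.mpr ⟨notMem_erase _ _, (insert_erase hj).symm, rfl⟩⟩

theorem tArray_cross (r₁ r₂ : TRow t a) (k₁ k₂ : Fin t) (x : TLabel t a)
    (hne : (r₁, k₁) ≠ (r₂, k₂)) (h₁ : tArray t a r₁ k₁ = some x) (h₂ : tArray t a r₂ k₂ = some x) :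
    r₁ ≠ r₂ ∧ k₁ ≠ k₂ ∧ tArray t a r₁ k₂ = none ∧ tArray t a r₂ k₁ = none := by
  obtain ⟨hk₁, hY₁, hi₁⟩ := tArray_eq_some_iff.mp h₁
  obtain ⟨hk₂, hY₂, hi₂⟩ := tArray_eq_some_iff.mp h₂
  have hinsert : insert k₁ r₁.1.1 = insert k₂ r₂.1.1 := hY₁.symm.trans hY₂
  have hk : k₁ ≠ k₂ := by
    rintro rfl
    have hY : r₁.1.1 = r₂.1.1 := by rw [← erase_insert hk₁, ← erase_insert hk₂, hinsert]
    exact hne (Prod.ext (TRow.ext_val hY (hi₁.symm.trans hi₂)) rfl)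
  have hmem₂ : k₂ ∈ r₁.1.1 :=
    mem_of_mem_insert_of_ne (hinsert ▸ mem_insert_self k₂ r₂.1.1) hk.symm
  have hmem₁ : k₁ ∈ r₂.1.1 :=
    mem_of_mem_insert_of_ne (hinsert ▸ mem_insert_self k₁ r₁.1.1) hk
  exact ⟨fun h => hk₁ (h ▸ hmem₁), hk, tArray_eq_none_iff.mpr hmem₂, tArray_eq_none_iff.mpr hmem₁⟩

theorem card_filter_tRow (p : Finset (Fin t) → Prop) [DecidablePred p] :
    #{r : TRow t a | p r.1.1} = ∑ Y with (1 ≤ #Y ∧ #Y < t) ∧ p Y, a #Y := by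
  rw [card_filter, Fintype.sum_sigma, ← filter_filter, sum_filter,
    sum_subtype _ (p := fun Y : Finset (Fin t) => 1 ≤ #Y ∧ #Y < t) (by simp)]
  exact sum_congr rfl fun Y _ => by split_ifs <;> simp

theorem card_tRow : Fintype.card (TRow t a) = ∑ s ∈ Ico 1 t, t.choose s * a s := by
  have hIco : {s ∈ range (t + 1) | 1 ≤ s ∧ s < t} = Ico 1 t := by grind
  have h := card_filter_tRow (a := a) fun _ : Finset (Fin t) => True
  simp only [filter_true, and_true, card_univ] at h
  rw [h, sum_filter_card (fun s => 1 ≤ s ∧ s < t), Fintype.card_fin, hIco]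

theorem card_filter_mem_tRow (j : Fin t) :
    #{r : TRow t a | j ∈ r.1.1} = ∑ s ∈ Ico 1 t, (t - 1).choose (s - 1) * a s := by
  have hIco : {s ∈ range t | 1 ≤ s + 1 ∧ s + 1 < t} = Ico 0 (t - 1) := by grind
  have hshift : Ico 1 t = Ico (0 + 1) (t - 1 + 1) := by rw [Nat.sub_add_cancel j.pos]
  rw [card_filter_tRow (fun Y => j ∈ Y), sum_filter_card_mem (fun s => 1 ≤ s ∧ s < t),
    Fintype.card_fin, hIco, hshift, ← sum_Ico_add']
  simp only [Nat.add_sub_cancel]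

/-- The symbols `(Y, i)` with `i ≤ c_{|Y| - 1}`, a set of symbols whose transmissions are to be
dropped. The index `i` starts at `0` here. -/
def removedLabels (t : ℕ) (a c : ℕ → ℕ) : Finset (TLabel t a) :=
  {x | (x.2 : ℕ) < c (#x.1.1 - 1)}

theorem card_filter_removedLabels (hc : c ≤ a) (p : Finset (Fin t) → Prop) [DecidablePred p] :
    #{x ∈ removedLabels t a c | p x.1.1} = ∑ Y : Finset (Fin t) with 2 ≤ #Y ∧ p Y, c (#Y - 1) := by
  rw [removedLabels, filter_filter, card_filter, Fintype.sum_sigma, ← filter_filter, sum_filter,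
    sum_subtype _ (p := fun Y : Finset (Fin t) => 2 ≤ #Y) (by simp)]
  refine sum_congr rfl fun Y _ => ?_
  by_cases hp : p Y
  · simp [hp, Fin.card_filter_val_lt, hc _]
  · simp [hp]

theorem card_removedLabels (hc : c ≤ a) :
    #(removedLabels t a c) = ∑ s ∈ Ico 1 t, t.choose (s + 1) * c s := by
  have hIco : {s ∈ range (t + 1) | 2 ≤ s} = Ico (1 + 1) (t + 1) := by grind
  have h := card_filter_removedLabels hc fun _ : Finset (Fin t) => True
  simp only [filter_true, and_true] at h
  rw [h, sum_filter_card (2 ≤ ·) fun s => c (s - 1), Fintype.card_fin, hIco, ← sum_Ico_add']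
  simp only [Nat.add_sub_cancel]

theorem card_filter_mem_removedLabels (hc : c ≤ a) (j : Fin t) :
    #{x ∈ removedLabels t a c | j ∈ x.1.1} = ∑ s ∈ Ico 1 t, (t - 1).choose s * c s := by
  have hIco : {s ∈ range t | 2 ≤ s + 1} = Ico 1 t := by grind
  rw [card_filter_removedLabels hc fun Y => j ∈ Y, sum_filter_card_mem (2 ≤ ·) fun s => c (s - 1),
    Fintype.card_fin, hIco]
  simp only [Nat.add_sub_cancel]

theorem card_tLabel : Fintype.card (TLabel t a) = ∑ s ∈ Ico 1 t, t.choose (s + 1) * a s := by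
  have huniv : removedLabels t a a = univ := by simp [removedLabels]
  rw [← card_univ, ← huniv, card_removedLabels le_rfl]

theorem isPDA_tArray : IsPDA (tArray t a) (∑ s ∈ Ico 1 t, t.choose s * a s)
    (∑ s ∈ Ico 1 t, (t - 1).choose (s - 1) * a s) (∑ s ∈ Ico 1 t, t.choose (s + 1) * a s) where
  card_rows := card_tRow
  card_integers := card_tLabel
  stars j := by
    simp only [tArray_eq_none_iff]
    rw [← card_filter_mem_tRow j, Set.ncard_eq_toFinset_card', Set.toFinset_ofPred]
  occurs x := by
    obtain ⟨j, hj⟩ : x.1.1.Nonempty := card_pos.mp (by have := x.1.2; omega)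
    obtain ⟨r, hr⟩ := exists_tArray_eq_some_iff.mpr hj
    exact ⟨r, j, hr⟩
  cross := tArray_cross

theorem isRemovable_removedLabels {Z : ℕ} (hc : c ≤ a)
    (hZ : ∑ s ∈ Ico 1 t, (t - 1).choose s * c s + ∑ s ∈ Ico 1 t, (t - 1).choose (s - 1) * a s ≤ Z) :
    IsRemovable (tArray t a) Z (∑ s ∈ Ico 1 t, (t - 1).choose (s - 1) * a s)
      (removedLabels t a c) := by
  intro j
  simp only [exists_tArray_eq_some_iff]
  rwa [Set.ncard_eq_toFinset_card', Set.toFinset_ofPred, ← filter_filter, filter_univ_mem,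
    card_filter_mem_removedLabels hc j]

end TArray

/-! ### Block counts of designs -/

/-- The number of blocks that contain `X` and are disjoint from `Y`, blocks being counted with
their multiplicity in the family. -/
def blockCount {β : Type*} [Fintype β] {v : ℕ} (blk : β → Finset (Fin v)) (X Y : Finset (Fin v)) :
    ℕ :=
  Fintype.card {i // X ⊆ blk i ∧ Disjoint Y (blk i)}

namespace IsTDesign

open Finset

variable {β : Type*} [Fintype β] {t v k lam : ℕ} {blk : β → Finset (Fin v)}

theorem blockCount_add_blockCount_insert (blk : β → Finset (Fin v)) (X Y : Finset (Fin v))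
    (y : Fin v) :
    blockCount blk X (insert y Y) + blockCount blk (insert y X) Y = blockCount blk X Y := by
  simp only [blockCount, Fintype.card_subtype]
  rw [← card_filter_add_card_filter_not (s := {i | X ⊆ blk i ∧ Disjoint Y (blk i)}) (y ∉ blk ·),
    filter_filter, filter_filter]
  congr 2 <;> ext i <;> simp [insert_subset_iff] <;> tauto

/-- Double counting of the pairs of a block and a `t`-set between `X` and this block. -/
theorem blockCount_empty_mul (h : IsTDesign t v k lam blk) {X : Finset (Fin v)} (hX : #X ≤ t) :
    blockCount blk X ∅ * (k - #X).choose (t - #X) = (v - #X).choose (t - #X) * lam := by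
  have hcount := sum_card_bipartiteAbove_eq_sum_card_bipartiteBelow
    (s := {i | X ⊆ blk i}) (t := {Z ∈ powersetCard t univ | X ⊆ Z}) fun i Z => Z ⊆ blk i
  have habove : ∀ i ∈ ({i | X ⊆ blk i} : Finset β),
      #(bipartiteAbove (fun i Z => Z ⊆ blk i) {Z ∈ powersetCard t univ | X ⊆ Z} i) =
        (k - #X).choose (t - #X) := by
    intro i hi
    rw [← h.card_block i, ← card_filter_powersetCard_subset X _ t (mem_filter.mp hi).2 hX]
    congr 1
    ext Z
    simp [bipartiteAbove, mem_powersetCard]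
    tauto
  have hbelow : ∀ Z ∈ ({Z ∈ powersetCard t univ | X ⊆ Z} : Finset (Finset (Fin v))),
      #(bipartiteBelow (fun i Z => Z ⊆ blk i) {i | X ⊆ blk i} Z) = lam := by
    intro Z hZ
    obtain ⟨hcard, hXZ⟩ := mem_filter.mp hZ
    rw [← h.balanced Z (mem_powersetCard.mp hcard).2, Set.ncard_eq_toFinset_card',
      Set.toFinset_ofPred, bipartiteBelow, filter_filter]
    congr 1
    ext i
    simpa using hXZ.trans
  rw [sum_congr rfl habove, sum_congr rfl hbelow, sum_const, sum_const, smul_eq_mul, smul_eq_mul,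
    card_filter_powersetCard_subset _ _ _ (subset_univ X) hX, card_univ, Fintype.card_fin] at hcount
  simpa [blockCount, Fintype.card_subtype] using hcount

theorem blockCount_empty_mul_choose (h : IsTDesign t v k lam blk) {X : Finset (Fin v)}
    (hX : #X ≤ t) :
    blockCount blk X ∅ * (v - t).choose (k - t) = lam * (v - #X).choose (k - #X) := by
  have htk := h.t_le
  have hpos : 0 < (k - #X).choose (t - #X) := Nat.choose_pos (by omega)
  have hmul := Nat.choose_mul (n := v - #X) (k := k - #X) (s := t - #X) (by omega)
  rw [show v - #X - (t - #X) = v - t by omega, show k - #X - (t - #X) = k - t by omega] at hmul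
  refine Nat.eq_of_mul_eq_mul_right hpos ?_
  rw [mul_right_comm, h.blockCount_empty_mul hX, mul_assoc lam, hmul]
  ring

/-- By induction on `Y`: the recurrence of `blockCount_add_blockCount_insert` is Pascal's rule. -/
theorem blockCount_mul_choose (h : IsTDesign t v k lam blk) {X Y : Finset (Fin v)}
    (hXY : Disjoint X Y) (hcard : #X + #Y ≤ t) :
    blockCount blk X Y * (v - t).choose (k - t) = lam * (v - #X - #Y).choose (k - #X) := by
  have htk := h.t_le
  have hkv := h.k_lt
  induction Y using Finset.induction_on generalizing X with
  | empty => simpa using h.blockCount_empty_mul_choose (by simpa using hcard)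
  | insert y Y hy ih =>
    rw [disjoint_insert_right] at hXY
    rw [card_insert_of_notMem hy] at hcard
    have hX := ih hXY.2 (by omega)
    have hinsert := ih (X := insert y X) (disjoint_insert_left.mpr ⟨hy, hXY.2⟩)
      (by rw [card_insert_of_notMem hXY.1]; omega)
    have hpascal := Nat.choose_succ_succ' (v - #X - (#Y + 1)) (k - (#X + 1))
    rw [show v - #X - (#Y + 1) + 1 = v - #X - #Y by omega,
      show k - (#X + 1) + 1 = k - #X by omega] at hpascal
    rw [card_insert_of_notMem hXY.1, Nat.sub_right_comm, show v - #Y - (#X + 1) =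
      v - #X - (#Y + 1) by omega] at hinsert
    rw [← blockCount_add_blockCount_insert blk X Y y, hpascal, add_mul, mul_add, hinsert] at hX
    rw [card_insert_of_notMem hy]
    omega

theorem card_blocks_inter_eq (blk : β → Finset (Fin v)) (e : Fin t ↪ Fin v) (Y : Finset (Fin t)) :
    Fintype.card {i // ∀ j, e j ∈ blk i ↔ j ∈ Y} = blockCount blk (Y.map e) (Yᶜ.map e) := by
  refine Fintype.card_congr (Equiv.subtypeEquivRight fun i => ?_)
  simp only [subset_iff, disjoint_left, mem_map, mem_compl, forall_exists_index, and_imp,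
    forall_apply_eq_imp_iff₂, not_imp_not]
  exact ⟨fun h => ⟨fun j => (h j).mpr, fun j => (h j).mp⟩, fun h j => ⟨h.2 j, h.1 j⟩⟩

theorem le_card_blocks_inter_eq (h : IsTDesign t v k lam blk) {m : ℕ} (e : Fin t ↪ Fin v)
    {Y : Finset (Fin t)} (hm : m * (v - t).choose (k - t) ≤ lam * (v - t).choose (k - #Y)) :
    m ≤ Fintype.card {i // ∀ j, e j ∈ blk i ↔ j ∈ Y} := by
  have hpos : 0 < (v - t).choose (k - t) := Nat.choose_pos (by have := h.k_lt; omega)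
  have hcompl : #Y + #Yᶜ = t := by simp [card_add_card_compl]
  have hdisj : Disjoint (Y.map e) (Yᶜ.map e) := (disjoint_map e).mpr disjoint_compl_right
  have hcount := h.blockCount_mul_choose hdisj (by rw [card_map, card_map, hcompl])
  rw [card_map, card_map, Nat.sub_sub, hcompl] at hcount
  rw [card_blocks_inter_eq]
  exact Nat.le_of_mul_le_mul_right (hm.trans_eq hcount.symm) hpos

theorem exists_starAligned {β : Type*} [Finite β] {blk : β → Finset (Fin v)}
    (h : IsTDesign t v k lam blk) {a : ℕ → ℕ}
    (ha : ∀ s ∈ Ico 1 t, a s * (v - t).choose (k - t) ≤ lam * (v - t).choose (k - s))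
    (I : Finset (Fin v)) (hI : #I = t) :
    ∃ ψ : TRow t a ↪ β, StarAligned (designArray blk) (tArray t a) I hI ψ := by
  have := Fintype.ofFinite β
  let e : Fin t ↪ Fin v := (I.orderIsoOfFin hI).toEmbedding.trans (.subtype _)
  have hemb : ∀ Y : {Y : Finset (Fin t) // 1 ≤ #Y ∧ #Y < t},
      Nonempty (Fin (a #Y.1) ↪ {i // ∀ j, e j ∈ blk i ↔ j ∈ Y.1}) := fun Y => by
    rw [Function.Embedding.nonempty_iff_card_le, Fintype.card_fin]
    exact h.le_card_blocks_inter_eq e (ha _ (mem_Ico.mpr Y.2))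
  let g := fun Y => (hemb Y).some
  have hg : ∀ (r : TRow t a) j, e j ∈ blk (g r.1 r.2) ↔ j ∈ r.1.1 := fun r => (g r.1 r.2).2
  refine ⟨⟨fun r => g r.1 r.2, fun r r' hrr' => ?_⟩,
    fun r j => (hg r j).trans tArray_eq_none_iff.symm⟩
  have hY : r.1 = r'.1 := Subtype.ext <| Finset.ext fun j => by
    rw [← hg r j, ← hg r' j]
    exact iff_of_eq (congrArg (fun i => e j ∈ blk i) hrr')
  obtain ⟨Y, i⟩ := r
  obtain ⟨Y', i'⟩ := r'
  obtain rfl : Y = Y' := hY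
  exact congrArg _ ((g Y).injective (Subtype.ext hrr'))

theorem isHpPDA (h : IsTDesign t v k lam blk) {a : ℕ → ℕ} {Z : ℕ}
    (ha : ∀ s ∈ Ico 1 t, a s * (v - t).choose (k - t) ≤ lam * (v - t).choose (k - s))
    (hZ : Z * (v - t).choose (k - t) = lam * (v - 1).choose (k - 1))
    (hmem : Z < ∑ s ∈ Ico 1 t, t.choose s * a s) :
    IsHpPDA (designArray blk) (tArray t a) (Fintype.card β) (∑ s ∈ Ico 1 t, t.choose s * a s) Z
      (∑ s ∈ Ico 1 t, (t - 1).choose (s - 1) * a s)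
      (∑ s ∈ Ico 1 t, t.choose (s + 1) * a s) where
  users := (h.t_le.trans_lt h.k_lt).le
  rows := by
    obtain ⟨I, -, hI⟩ := exists_subset_card_eq (s := (univ : Finset (Fin v))) (n := t)
      (by simpa using (h.t_le.trans_lt h.k_lt).le)
    obtain ⟨ψ, -⟩ := h.exists_starAligned ha I hI
    exact card_tRow ▸ Fintype.card_le_of_embedding ψ
  memory := hmem
  card_rows := rfl
  stars x := by
    have hpos : 0 < (v - t).choose (k - t) := Nat.choose_pos (by have := h.k_lt; omega)
    have hx := h.blockCount_empty_mul_choose (X := {x}) h.t_pos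
    rw [card_singleton, ← hZ] at hx
    rw [← Nat.eq_of_mul_eq_mul_right hpos hx, blockCount, ← Nat.card_eq_fintype_card,
      ← Set.coe_ofPred, Nat.card_coe_set_eq]
    simp [designArray]
  pda := isPDA_tArray
  aligned := h.exists_starAligned ha

end IsTDesign

theorem sum_levels (f : ℕ → ℕ) (a₁ a₂ : ℕ) :
    ∑ s ∈ Finset.Ico 1 3, f s * levels a₁ a₂ s = f 1 * a₁ + f 2 * a₂ := by
  simp [Finset.sum_Ico_succ_top, levels]

theorem IsTDesign.isHpPDA_levels {β : Type*} [Fintype β] {K a₁ a₂ : ℕ} {blk : β → Finset (Fin K)}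
    (h : IsTDesign 3 K 4 3 blk) (ha₁ : a₁ ≤ (K - 4).choose 2) (ha₂ : 2 * a₂ ≤ 3 * (K - 4))
    (hmem : (K - 1).choose 2 < 3 * (a₁ + a₂)) :
    IsHpPDA (designArray blk) (tArray 3 (levels a₁ a₂)) (Fintype.card β) (3 * (a₁ + a₂))
      ((K - 1).choose 2) (a₁ + 2 * a₂) (3 * a₁ + a₂) := by
  obtain ⟨n, rfl⟩ : ∃ n, K = n + 5 := ⟨K - 5, by have := h.k_lt; omega⟩
  have htriples : (n + 2) * (n + 1).choose 2 = (n + 2).choose 3 * 3 := Nat.add_one_mul_choose_eq _ _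
  have hpairs : (n + 2) * (n + 1) = (n + 2).choose 2 * 2 := by
    simpa using Nat.add_one_mul_choose_eq (n + 1) 1
  have hstars : (n + 4).choose 3 * 3 = (n + 4).choose 2 * (n + 2) := Nat.choose_succ_right_eq _ _
  have hbound : ∀ s ∈ Finset.Ico 1 3,
      levels a₁ a₂ s * (n + 5 - 3).choose (4 - 3) ≤ 3 * (n + 5 - 3).choose (4 - s) := by
    intro s hs
    obtain rfl | rfl : s = 1 ∨ s = 2 := by grind
    · rw [show levels a₁ a₂ 1 = a₁ from rfl, Nat.choose_one_right]
      have := Nat.mul_le_mul_right (n + 2) ha₁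
      simp only [Nat.reduceSubDiff] at *
      linarith
    · rw [show levels a₁ a₂ 2 = a₂ from rfl, Nat.choose_one_right]
      have := Nat.mul_le_mul_right (n + 2) ha₂
      simp only [Nat.reduceSubDiff] at *
      linarith
  have hdegree : (n + 4).choose 2 * (n + 5 - 3).choose (4 - 3) = 3 * (n + 4).choose 3 := by
    rw [Nat.choose_one_right, mul_comm 3, hstars]
    simp
  have hpda := h.isHpPDA hbound hdegree (by rwa [sum_levels, Nat.choose_one_right,
    show Nat.choose 3 2 = 3 from rfl, ← mul_add])
  simp only [sum_levels] at hpda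
  convert hpda using 1 <;> simp [mul_add]

theorem levels_mono_right {a₁ a₂ a : ℕ} (ha : a ≤ a₂) : levels a₁ a ≤ levels a₁ a₂ := by
  intro s
  simp only [levels]
  split_ifs
  exacts [le_rfl, ha, le_rfl]

theorem card_removedLabels_levels {a₁ a₂ a : ℕ} (ha : a ≤ a₂) :
    (removedLabels 3 (levels a₁ a₂) (levels a₁ a)).card = 3 * a₁ + a := by
  rw [card_removedLabels (levels_mono_right ha), sum_levels]
  simp

theorem isRemovable_removedLabels_levels {a₁ a₂ a Z : ℕ} (ha : a ≤ a₂)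
    (hZ : a + 3 * a₁ + 2 * a₂ ≤ Z) :
    IsRemovable (tArray 3 (levels a₁ a₂)) Z (a₁ + 2 * a₂)
      (removedLabels 3 (levels a₁ a₂) (levels a₁ a)) := by
  have hle : levels a₁ a ≤ levels a₁ a₂ := levels_mono_right ha
  have hremovable := isRemovable_removedLabels (t := 3) (Z := Z) hle (by
    simp only [sum_levels, Nat.reduceSub, Nat.choose_one_right, Nat.choose_zero_right,
      Nat.choose_self]
    linarith)
  simpa [sum_levels] using hremovable

/-! ### Designs from one-factorizations -/

/-- A one-factorization of the complete graph on `X`. The factor with index `i` is encoded by the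
fixed point free involution `f i` that swaps the two ends of each of its edges. -/
structure IsOneFactorization {ι X : Type*} (f : ι → X → X) : Prop where
  involutive : ∀ i, Function.Involutive (f i)
  existsUnique : ∀ x y, x ≠ y → ∃! i, f i x = y
  ne_self : ∀ i x, f i x ≠ x

theorem IsOneFactorization.conj {ι X X' : Type*} {f : ι → X → X} (h : IsOneFactorization f)
    (e : X ≃ X') : IsOneFactorization fun i x => e (f i (e.symm x)) where
  involutive i x := by simp only [Equiv.symm_apply_apply, h.involutive i _, Equiv.apply_symm_apply]
  existsUnique x y hxy := by
    simpa only [← Equiv.eq_symm_apply] using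
      h.existsUnique (e.symm x) (e.symm y) (e.symm.injective.ne hxy)
  ne_self i x := by simpa only [ne_eq, ← Equiv.eq_symm_apply] using h.ne_self i (e.symm x)

/-- The reflection `x ↦ 2 i - x` of an abelian group in `i`, made fixed point free by matching `i`
with the additional point `none` (if no other point is fixed). -/
def reflection {G : Type*} [AddCommGroup G] [DecidableEq G] (i : G) : Option G → Option G
  | none => some i
  | some x => if x = i then none else some (2 • i - x)

section Reflection

variable {G : Type*} [AddCommGroup G] [DecidableEq G]

theorem reflection_some_of_ne {i x : G} (h : x ≠ i) : reflection i (some x) = some (2 • i - x) :=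
  if_neg h

theorem reflection_some_eq_none {i x : G} : reflection i (some x) = none ↔ i = x := by
  simp [reflection, eq_comm]

theorem reflection_involutive (i : G) : Function.Involutive (reflection i) := by
  rintro (_ | x)
  · exact if_pos rfl
  · rcases eq_or_ne x i with rfl | hx
    · exact congrArg _ (if_pos rfl)
    · have hne : 2 • i - x ≠ i := fun h => hx (by rwa [two_nsmul, add_sub_assoc, add_eq_left,
        sub_eq_zero, eq_comm] at h)
      rw [reflection_some_of_ne hx, reflection_some_of_ne hne, sub_sub_cancel]

theorem reflection_ne_self (h2 : Function.Injective fun x : G => 2 • x) (i : G) (x : Option G) :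
    reflection i x ≠ x := by
  rcases x with _ | x
  · exact Option.some_ne_none i
  · rcases eq_or_ne x i with rfl | hx
    · rw [reflection_some_eq_none.mpr rfl]
      exact (Option.some_ne_none x).symm
    · rw [reflection_some_of_ne hx]
      intro h
      rw [Option.some.injEq, sub_eq_iff_eq_add, ← two_nsmul] at h
      exact hx (h2 h.symm)

theorem reflection_some_eq_some {i x y : G} (hxy : x ≠ y) :
    reflection i (some x) = some y ↔ 2 • i = x + y := by
  rcases eq_or_ne x i with rfl | hx
  · rw [reflection_some_eq_none.mpr rfl, two_nsmul, add_right_inj]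
    simp [hxy]
  · rw [reflection_some_of_ne hx, Option.some.injEq, sub_eq_iff_eq_add']

theorem existsUnique_reflection (h2 : Function.Bijective fun x : G => 2 • x) {x y : Option G}
    (hxy : x ≠ y) : ∃! i, reflection i x = y := by
  rcases x with _ | x <;> rcases y with _ | y
  · exact absurd rfl hxy
  · simp [reflection]
  · simp [reflection_some_eq_none]
  · simpa only [reflection_some_eq_some (ne_of_apply_ne some hxy)] using
      h2.existsUnique (x + y)

theorem isOneFactorization_reflection (h2 : Function.Bijective fun x : G => 2 • x) :
    IsOneFactorization (reflection (G := G)) where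
  involutive := reflection_involutive
  existsUnique _ _ := existsUnique_reflection h2
  ne_self := reflection_ne_self h2.injective

end Reflection

namespace IsOneFactorization

variable {ι X : Type*} {f : ι → X → X}

/-- A union of two edges of a common factor, together with (the index of) this factor. Such unions
are encoded as the four-point sets that are closed under the involution of the factor. -/
abbrev Block (f : ι → X → X) : Type _ :=
  {p : ι × Finset X // p.2.card = 4 ∧ ∀ x ∈ p.2, f p.1 x ∈ p.2}

variable {i : ι} {x y z : X}

theorem apply_eq_comm (h : IsOneFactorization f) : f i x = y ↔ f i y = x := by
  rw [eq_comm, ← (h.involutive i).eq_iff]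

theorem card_block [DecidableEq X] (h : IsOneFactorization f) (hxy : x ≠ y) (hxz : x ≠ z)
    (hyz : y ≠ z) (hi : f i x = y) : ({x, y, z, f i z} : Finset X).card = 4 := by
  have hx : f i z ≠ x := fun hz => hyz (hi.symm.trans (h.apply_eq_comm.mp hz))
  have hy : f i z ≠ y := fun hz => hxz ((h.involutive i).injective (hi.trans hz.symm))
  have hz := h.ne_self i z
  simp [Finset.card_insert_of_notMem, *, hx.symm, hy.symm, hz.symm]

/-- Otherwise the two points and their images are five distinct points with the third. -/
theorem eq_or_eq_or_eq_of_mem (h : IsOneFactorization f) {A : Finset X} (hcard : A.card = 4)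
    (hA : ∀ w ∈ A, f i w ∈ A) (hxy : x ≠ y) (hxz : x ≠ z) (hyz : y ≠ z) (hx : x ∈ A) (hy : y ∈ A)
    (hz : z ∈ A) : f i x = y ∨ f i x = z ∨ f i y = z := by
  classical
  by_contra! hne
  obtain ⟨hne_xy, hne_xz, hne_yz⟩ := hne
  have hfive : ({x, y, z, f i x, f i y} : Finset X).card = 5 := by
    have hne_yx : f i y ≠ x := fun e => hne_xy (h.apply_eq_comm.mp e)
    have hinj := (h.involutive i).injective.ne hxy
    have hx' := (h.ne_self i x).symm
    have hy' := (h.ne_self i y).symm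
    simp [Finset.card_insert_of_notMem, *, hne_xy.symm, hne_xz.symm, hne_yz.symm, hne_yx.symm]
  have hsub : ({x, y, z, f i x, f i y} : Finset X) ⊆ A := by
    simp [Finset.insert_subset_iff, hx, hy, hz, hA]
  have := Finset.card_le_card hsub
  omega

theorem existsUnique_block [DecidableEq X] (h : IsOneFactorization f) (hxy : x ≠ y) (hxz : x ≠ z)
    (hyz : y ≠ z) : ∃! p : Block f, f p.1.1 x = y ∧ {x, y, z} ⊆ p.1.2 := by
  obtain ⟨i, hi, hunique⟩ := h.existsUnique x y hxy
  refine ⟨⟨(i, {x, y, z, f i z}), h.card_block hxy hxz hyz hi, ?_⟩, ⟨hi, ?_⟩, ?_⟩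
  · simp [h.apply_eq_comm.mp hi, hi, h.involutive i z]
  · simp [Finset.insert_subset_iff]
  · rintro ⟨⟨i', A⟩, hcard, hA⟩ ⟨hi', hsub⟩
    obtain rfl := hunique i' hi'
    simp only [Finset.insert_subset_iff, Finset.singleton_subset_iff] at hsub
    have hsub' : {x, y, z, f i' z} ⊆ A := by simp [Finset.insert_subset_iff, hsub, hA]
    have heq := Finset.eq_of_subset_of_card_le hsub' (by rw [hcard, h.card_block hxy hxz hyz hi'])
    simp [heq]

theorem ncard_blocks_of_triple (h : IsOneFactorization f) {Y : Finset X} (hY : Y.card = 3) :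
    {p : Block f | Y ⊆ p.1.2}.ncard = 3 := by
  classical
  obtain ⟨x, y, z, hxy, hxz, hyz, rfl⟩ := Finset.card_eq_three.mp hY
  obtain ⟨p, ⟨hp, hmem_p⟩, hunique_p⟩ := h.existsUnique_block hxy hxz hyz
  obtain ⟨q, ⟨hq, hmem_q⟩, hunique_q⟩ := h.existsUnique_block hxz hxy hyz.symm
  obtain ⟨r, ⟨hr, hmem_r⟩, hunique_r⟩ := h.existsUnique_block hyz hxy.symm hxz.symm
  have hpq : p ≠ q := fun e => hyz (hp.symm.trans (e ▸ hq))
  have hpr : p ≠ r := fun e => hxz ((h.apply_eq_comm.mp hp).symm.trans (e ▸ hr))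
  have hqr : q ≠ r := fun e => hxy ((h.involutive _).injective (hq.trans (e ▸ hr).symm))
  simp only [Finset.insert_subset_iff, Finset.singleton_subset_iff] at *
  refine Set.ncard_eq_three.mpr ⟨p, q, r, hpq, hpr, hqr, Set.ext fun s => ⟨?_, ?_⟩⟩
  · rintro ⟨hx, hy, hz⟩
    rcases h.eq_or_eq_or_eq_of_mem s.2.1 s.2.2 hxy hxz hyz hx hy hz with hs | hs | hs
    · exact Or.inl (hunique_p s ⟨hs, hx, hy, hz⟩)
    · exact Or.inr (Or.inl (hunique_q s ⟨hs, hx, hz, hy⟩))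
    · exact Or.inr (Or.inr (hunique_r s ⟨hs, hy, hz, hx⟩))
  · rintro (rfl | rfl | rfl)
    · exact hmem_p
    · exact ⟨hmem_q.1, hmem_q.2.2, hmem_q.2.1⟩
    · exact ⟨hmem_r.2.2, hmem_r.1, hmem_r.2.1⟩

theorem isTDesign {v : ℕ} {f : ι → Fin v → Fin v} (h : IsOneFactorization f) (hv : 4 < v) :
    IsTDesign 3 v 4 3 fun p : Block f => p.1.2 where
  t_pos := by norm_num
  lam_pos := by norm_num
  t_le := by norm_num
  k_lt := hv
  card_block p := p.2.1
  balanced _ := h.ncard_blocks_of_triple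

end IsOneFactorization

theorem IsTDesign.comp_equiv {β β' : Type*} {t v k lam : ℕ} {blk : β → Finset (Fin v)}
    (h : IsTDesign t v k lam blk) (e : β' ≃ β) : IsTDesign t v k lam (blk ∘ e) where
  t_pos := h.t_pos
  lam_pos := h.lam_pos
  t_le := h.t_le
  k_lt := h.k_lt
  card_block i := h.card_block (e i)
  balanced Y hY := by
    rw [← h.balanced Y hY]
    exact Set.ncard_preimage_of_injective_subset_range (s := {i | Y ⊆ blk i}) e.injective
      (e.range_eq_univ ▸ Set.subset_univ _)

theorem exists_isTDesign_of_even {K : ℕ} (hK : Even K) (hK4 : 4 < K) :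
    ∃ (b : ℕ) (blk : Fin b → Finset (Fin K)), IsTDesign 3 K 4 3 blk := by
  have : NeZero (K - 1) := ⟨by omega⟩
  have hcoprime : (Nat.card (ZMod (K - 1))).Coprime 2 := by
    rw [Nat.card_zmod, Nat.coprime_two_right]
    exact Nat.Even.sub_odd (by omega) hK odd_one
  let e : Option (ZMod (K - 1)) ≃ Fin K := Fintype.equivFinOfCardEq <| by
    rw [Fintype.card_option, ZMod.card]
    omega
  have hdesign := ((isOneFactorization_reflection (nsmulCoprime hcoprime).bijective).conj
    e).isTDesign hK4
  exact ⟨_, _, hdesign.comp_equiv (Finite.equivFin _).symm⟩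

/-! ### Achievability and the cut-set bound -/

theorem HotplugScheme.Correct.hotplugAchievable {K K' N B c l : ℕ} {File Signal : Type*}
    {Cache : Fin K → Type*} [Fintype File] [∀ k, Fintype (Cache k)] [Fintype Signal]
    {s : HotplugScheme K K' N File Cache Signal} (hs : s.Correct) (hB : 0 < B)
    (hFile : 2 ^ B ≤ Fintype.card File) (hCache : ∀ k, Fintype.card (Cache k) ≤ 2 ^ c)
    (hSignal : Fintype.card Signal ≤ 2 ^ l) {M R : ℝ} (hM : c ≤ M * B) (hR : l ≤ R * B) :
    HotplugAchievable K K' N M R := by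
  have hbits : ∀ n, Fintype.card (Fin n → Bool) = 2 ^ n := fun n => by simp
  rw [← hbits] at hFile hSignal
  simp only [← hbits] at hCache
  obtain ⟨file⟩ := Function.Embedding.nonempty_of_card_le hFile
  obtain ⟨signal⟩ := Function.Embedding.nonempty_of_card_le hSignal
  let cache := fun k => (Function.Embedding.nonempty_of_card_le (hCache k)).some
  have : Nonempty File := ⟨file fun _ => false⟩
  refine ⟨B, c, l, hB, hM, hR, ⟨fun k W => cache k (s.place k (file ∘ W)),
    fun I hI d W => signal (s.deliver I hI d (file ∘ W))⟩, HotplugScheme.correct_iff.mpr ?_⟩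
  intro I hI d k W W' hplace hdeliver
  exact file.injective (HotplugScheme.correct_iff.mp hs I hI d k _ _
    ((cache k).injective hplace) (signal.injective hdeliver))

theorem IsHpPDA.hotplugAchievable {φ ρ σ : Type*} [Fintype φ] [Fintype ρ] [Fintype σ]
    {K K' N F F' Z Z' S : ℕ} {P : φ → Fin K → Prop} {B : ρ → Fin K' → Option σ} {T : Finset σ}
    (h : IsHpPDA P B F F' Z Z' S) (hT : IsRemovable B Z Z' T) (hN : 0 < N) {M R : ℝ}
    (hM : (Z / F' : ℝ) ≤ M / N) (hR : (S - T.card : ℝ) / F' ≤ R) :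
    HotplugAchievable K K' N M R := by
  classical
  have hF' : 0 < F' := (Nat.zero_le Z).trans_lt h.memory
  rw [div_le_div_iff₀ (by exact_mod_cast hF') (by exact_mod_cast hN)] at hM
  rw [div_le_iff₀ (by exact_mod_cast hF')] at hR
  have hF : 0 < F := hF'.trans_le h.rows
  have : Fact (Nat.Prime 2) := ⟨Nat.prime_two⟩
  have : Fintype (GaloisField 2 F) := Fintype.ofFinite _
  have hfield : Fintype.card (GaloisField 2 F) = 2 ^ F := by
    rw [← Nat.card_eq_fintype_card, GaloisField.card 2 F hF.ne']
  obtain ⟨G, hG⟩ := exists_isMDS (ρ := ρ) (φ := φ) (𝔽 := GaloisField 2 F) <| by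
    rw [hfield, h.card_rows]
    exact Nat.lt_two_pow_self.le
  choose ζ hζ using h.aligned
  refine (h.correct_hpPDAScheme (N := N) hT hG hζ).hotplugAchievable (B := F * F')
    (c := F * (Z * N)) (l := F * (S - T.card)) (Nat.mul_pos hF hF') ?_ (fun k => ?_) ?_ ?_ ?_
  · rw [Fintype.card_fun, hfield, h.pda.card_rows, pow_mul]
  · have hcached : Fintype.card {f // P f k} = Z := by
      rw [← h.stars k, ← Nat.card_coe_set_eq, Nat.card_eq_fintype_card]
      rfl
    rw [Fintype.card_fun, Fintype.card_fun, Fintype.card_fin, hfield, hcached, pow_mul, pow_mul]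
  · rw [Fintype.card_fun, hfield, Fintype.card_subtype_compl, h.pda.card_integers,
      Fintype.card_coe, pow_mul]
  · push_cast
    nlinarith
  · rw [Nat.cast_mul, Nat.cast_sub (h.pda.card_integers ▸ T.card_le_univ), Nat.cast_mul]
    nlinarith

/-- A single user that demands the files one after the other recovers all of them from its cache and
`N` transmissions. -/
theorem HotplugAchievable.one_le_add {K K' N : ℕ} (hK' : 0 < K') (hK : K' ≤ K) (hN : 0 < N)
    {M R : ℝ} (h : HotplugAchievable K K' N M R) : 1 ≤ M / N + R := by
  obtain ⟨B, c, l, hB, hc, hl, s, hs⟩ := h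
  obtain ⟨I, -, hI⟩ := Finset.exists_subset_card_eq
    (s := (Finset.univ : Finset (Fin K))) (n := K') (by simpa using hK)
  obtain ⟨k, hk⟩ : I.Nonempty := Finset.card_pos.mp (by omega)
  have hinj : Function.Injective fun W : Fin N → Fin B → Bool =>
      (s.place k W, fun n : Fin N => s.deliver I hI (fun _ => n) W) := by
    intro W W' hWW'
    obtain ⟨hplace, hdeliver⟩ := Prod.mk.inj hWW'
    exact funext fun n => HotplugScheme.correct_iff.mp hs I hI (fun _ => n) ⟨k, hk⟩ W W' hplace
      (congrFun hdeliver n)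
  have hcard := Fintype.card_le_of_injective _ hinj
  simp only [Fintype.card_prod, Fintype.card_fun, Fintype.card_bool, Fintype.card_fin, ← pow_mul,
    ← pow_add] at hcard
  have hbits : (B * N : ℝ) ≤ c + l * N := by
    exact_mod_cast (Nat.pow_le_pow_iff_right (by norm_num)).mp hcard
  have hB' : (0 : ℝ) < B := by exact_mod_cast hB
  have hN' : (0 : ℝ) < N := by exact_mod_cast hN
  have hfiles : N * B ≤ (M + R * N) * B := by nlinarith
  rw [div_add' _ _ _ hN'.ne', one_le_div hN']
  exact le_of_mul_le_mul_right hfiles hB'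

/-- For `s ≥ 2` users, `M / N ≥ 1 / 3 ≥ 1 / (s + 1)` gives
`s - s / ⌊N / s⌋ * M ≤ s - s ^ 2 * (M / N) ≤ 1 - M / N`. -/
theorem isGreatest_cutSetValues {N K' : ℕ} {M : ℝ} (hN : 1 ≤ N) (hK' : 1 ≤ K')
    (hM : 1 / 3 ≤ M / N) : IsGreatest (cutSetValues N K' M) (1 - M / N) := by
  refine ⟨⟨1, ⟨le_rfl, le_min hN hK'⟩, by simp; ring⟩, ?_⟩
  rintro _ ⟨s, ⟨hs, hsmin⟩, rfl⟩
  have hpos : (0 : ℝ) < (N / s : ℕ) := by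
    exact_mod_cast Nat.div_pos (hsmin.trans (min_le_left _ _)) hs
  have hratio : (s : ℝ) ≤ N / (N / s : ℕ) := by
    rw [le_div_iff₀ hpos, mul_comm]
    exact_mod_cast Nat.div_mul_le_self N s
  have hN' : (N : ℝ) ≠ 0 := by positivity
  have hvalue : (s : ℝ) / (N / s : ℕ) * M = s * (N / (N / s : ℕ)) * (M / N) := by field_simp
  have hsquare : (s : ℝ) * s * (M / N) ≤ s * (N / (N / s : ℕ)) * (M / N) := by gcongr
  have hfactor : (0 : ℝ) ≤ (s - 1) * ((s + 1) * (M / N) - 1) := by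
    rcases hs.eq_or_lt with rfl | hs
    · simp
    · have hs' : (2 : ℝ) ≤ s := by exact_mod_cast hs
      exact mul_nonneg (by linarith) (by nlinarith)
  simp only [hvalue]
  linarith

theorem mainTheorem3 (K N a₁ a₂ a : ℕ) (hKeven : Even K) (hK : 6 ≤ K) (hN : 1 ≤ N)
    (ha₁ : a₁ ≤ (K - 4).choose 2) (ha₂ : (a₂ : ℝ) ≤ 3 / 2 * ((K : ℝ) - 4))
    (ha : a < a₂) (hsum : (K - 1).choose 2 = a + 3 * a₁ + 2 * a₂)
    (M R : ℝ) (hM : M / N = ((K - 1).choose 2 : ℝ) / (3 * ((a₁ : ℝ) + a₂)))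
    (hR : R = (3 * ((a₁ : ℝ) + a₂) - ((K - 1).choose 2 : ℝ)) / (3 * ((a₁ : ℝ) + a₂))) :
    -- `R` is the least rate achievable with memory `M`
    IsLeast {R' : ℝ | HotplugAchievable K 3 N M R'} R ∧
    -- the point meets the cut-set bound
    R = 1 - M / N ∧ IsGreatest (cutSetValues N 3 M) R ∧
    -- `3`-`(K, 4, 3)` designs exist, and each of them yields the point by the improved `t`-scheme
    (∃ (b : ℕ) (blk : Fin b → Finset (Fin K)), IsTDesign 3 K 4 3 blk) ∧
    ∀ (b : ℕ) (blk : Fin b → Finset (Fin K)), IsTDesign 3 K 4 3 blk →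
      IsHpPDA (designArray blk) (tArray 3 (levels a₁ a₂))
        b (3 * (a₁ + a₂)) ((K - 1).choose 2) (a₁ + 2 * a₂) (3 * a₁ + a₂) ∧
      ∃ T : Finset (TLabel 3 (levels a₁ a₂)),
        IsRemovable (tArray 3 (levels a₁ a₂)) ((K - 1).choose 2) (a₁ + 2 * a₂) T ∧
        R = (((3 * a₁ + a₂ : ℕ) : ℝ) - T.card) / ((3 * (a₁ + a₂) : ℕ) : ℝ) ∧
        ∀ (𝔽 : Type) [Field 𝔽] [Fintype 𝔽],
          (b ≤ Fintype.card 𝔽 →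
            ∃ G : Matrix (TRow 3 (levels a₁ a₂)) (Fin b) 𝔽, IsMDS G) ∧
          ∀ G : Matrix (TRow 3 (levels a₁ a₂)) (Fin b) 𝔽, IsMDS G →
            ∀ ζ : (I : Finset (Fin K)) → I.card = 3 → (TRow 3 (levels a₁ a₂) ↪ Fin b),
              (∀ I hI, StarAligned (designArray blk) (tArray 3 (levels a₁ a₂)) I hI (ζ I hI)) →
              (hpPDAScheme N (designArray blk) (tArray 3 (levels a₁ a₂)) ζ T G).Correct := by
  have hsumℝ : ((K - 1).choose 2 : ℝ) = a + 3 * a₁ + 2 * a₂ := mod_cast hsum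
  have ha₂' : 2 * a₂ ≤ 3 * (K - 4) := by
    zify [show 4 ≤ K by omega]
    exact_mod_cast (show (2 * a₂ : ℝ) ≤ 3 * (K - 4) by linarith)
  have hF' : (0 : ℝ) < 3 * (a₁ + a₂) := by have := a.zero_le.trans_lt ha; positivity
  have hRM : R = 1 - M / N := by rw [hR, hM, sub_div, div_self hF'.ne']
  have hM_third : 1 / 3 ≤ M / N := by
    rw [hM, hsumℝ, div_le_div_iff₀ (by norm_num) hF']
    linarith [a.cast_nonneg (α := ℝ), a₁.cast_nonneg (α := ℝ)]
  have hT := isRemovable_removedLabels_levels (a₁ := a₁) ha.le hsum.ge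
  set T := removedLabels 3 (levels a₁ a₂) (levels a₁ a)
  have hRT : R = (((3 * a₁ + a₂ : ℕ) : ℝ) - T.card) / ((3 * (a₁ + a₂) : ℕ) : ℝ) := by
    rw [hR, card_removedLabels_levels ha.le, hsumℝ]
    push_cast
    ring
  have hPDA (b : ℕ) (blk : Fin b → Finset (Fin K)) (hd : IsTDesign 3 K 4 3 blk) :=
    Fintype.card_fin b ▸ hd.isHpPDA_levels ha₁ ha₂' (show _ < 3 * (a₁ + a₂) by omega)
  obtain ⟨b, blk, hd⟩ := exists_isTDesign_of_even hKeven (by omega)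
  have hach := (hPDA b blk hd).hotplugAchievable hT hN (by exact_mod_cast hM.ge) hRT.ge
  exact ⟨⟨hach, fun R' hR' => by linarith [hR'.one_le_add (by norm_num) (by omega) hN]⟩, hRM,
    hRM ▸ isGreatest_cutSetValues hN (by norm_num) hM_third, ⟨b, blk, hd⟩, fun b blk hd =>
      ⟨hPDA b blk hd, T, hT, hRT, fun 𝔽 _ _ => ⟨fun hb => exists_isMDS (by simpa using hb),
        fun G hG ζ hζ => (hPDA b blk hd).correct_hpPDAScheme hT hG hζ⟩⟩⟩
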